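/- Work in the universe $V$ of sets (with the axiom of choice), let $A$ be a class and let $\kappa$ be a cardinal. For an ordinal $\alpha$ consider the structure $\langle V_\alpha,\in,A\cap V_\alpha\rangle$, where $V_\alpha$ is the $\alpha$-th level of the von Neumann hierarchy and $A\cap V_\alpha$ interprets a unary predicate symbol. The critical point of an elementary embedding between two such structures is the least ordinal of its domain that it moves. The cardinal $\kappa$ is called $A$-extendible if for every ordinal $\lambda>\kappa$ there are an ordinal $\theta$ and an elementary embedding $$j:\langle V_\lambda,\in,A\cap V_\lambda\rangle\to\langle V_\theta,\in,A\cap V_\theta\rangle$$ with critical point $\kappa$ and $\lambda<j(\kappa)$. Lemma. The cardinal $\kappa$ is $A$-extendible if and only if for every ordinal $\lambda>\kappa$ there are an ordinal $\theta$ and an elementary embedding $j:\langle V_\lambda,\in,A\cap V_\lambda\rangle\to\langle V_\theta,\in,A\cap V_\theta\rangle$ with critical point $\kappa$. -/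

import Mathlib

open scoped ZFSet FirstOrder

universe u

/-- The relation symbols of the language of set theory with one additional unary predicate. -/
inductive SetPredRel : ℕ → Type
  /-- The binary relation symbol for membership. -/
  | mem : SetPredRel 2
  /-- The unary predicate symbol for a class. -/
  | pred : SetPredRel 1

/-- The relational first-order language `{∈, A}` of structures `⟨M, ∈, A ∩ M⟩`. -/
def setPredLang : FirstOrder.Language.{0, 0} := ⟨fun _ => Empty, SetPredRel⟩

/-- The domain `V_α` of the structure `⟨V_α, ∈, A ∩ V_α⟩`. The class `A` is only used in the
interpretation of the predicate symbol, see the instance below. -/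
@[nolint unusedArguments]
def RankStruct (_A : Class.{u}) (α : Ordinal.{u}) : Type (u + 1) :=
  {x : ZFSet.{u} // x ∈ V_ α}

/-- The first-order structure `⟨V_α, ∈, A ∩ V_α⟩`. -/
instance RankStruct.instStructure (A : Class.{u}) (α : Ordinal.{u}) :
    setPredLang.Structure (RankStruct A α) where
  funMap f _ := Empty.elim f
  RelMap := fun {_} r =>
    match r with
    | SetPredRel.mem => fun v => (v 0).val ∈ (v 1).val
    | SetPredRel.pred => fun v => A (v 0).val

/-- A von Neumann ordinal `β < α`, as an element of `V_α`. -/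
noncomputable def RankStruct.ofOrdinal (A : Class.{u}) {α β : Ordinal.{u}} (h : β < α) :
    RankStruct A α :=
  ⟨β.toZFSet, by rw [ZFSet.mem_vonNeumann, Ordinal.rank_toZFSet]; exact h⟩

/-- The ordinal `κ` is the critical point of the elementary embedding
`j : ⟨V_lam, ∈, A ∩ V_lam⟩ → ⟨V_θ, ∈, A ∩ V_θ⟩`: it is the least ordinal of the domain
that is moved by `j`. -/
def IsCriticalPoint {A : Class.{u}} {lam θ : Ordinal.{u}}
    (j : RankStruct A lam ↪ₑ[setPredLang] RankStruct A θ) (κ : Ordinal.{u}) : Prop :=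
  ∃ hκ : κ < lam,
    (j (RankStruct.ofOrdinal A hκ)).val ≠ κ.toZFSet ∧
    ∀ (β : Ordinal.{u}) (hβ : β < κ),
      (j (RankStruct.ofOrdinal A (hβ.trans hκ))).val = β.toZFSet

/-- The cardinal `κ` is `A`-extendible: for every ordinal `lam > κ` there are an ordinal `θ` and an
elementary embedding `j : ⟨V_lam, ∈, A ∩ V_lam⟩ → ⟨V_θ, ∈, A ∩ V_θ⟩` with critical point `κ` and
`lam < j(κ)`; the order of von Neumann ordinals is membership. -/
def IsExtendibleFor (A : Class.{u}) (κ : Cardinal.{u}) : Prop :=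
  ∀ (lam : Ordinal.{u}) (hlam : κ.ord < lam),
    ∃ (θ : Ordinal.{u}) (j : RankStruct A lam ↪ₑ[setPredLang] RankStruct A θ),
      IsCriticalPoint j κ.ord ∧
      lam.toZFSet ∈ (j (RankStruct.ofOrdinal A hlam)).val

open FirstOrder Language

/-! ### Predicates defined by one formula in all levels. -/

namespace RankStruct

variable {A : Class.{u}}

/-! Only the construction of embeddings with `λ < j(κ)` needs work. Suppose that for some `λ` every
embedding `k` of `V_λ` with critical point `κ` has `k(κ) ≤ λ`. The values `k(κ)` then form a set, so
some limit `δ > λ` exceeds, for each value, the height `ζ` of a target `V_ζ` in which it is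
attained. Take `j : V_δ → V_θ` with critical point `κ`. Restricting `j` to `V_λ` shows that `j(κ)`
is a value; if `β = k(κ)` is a value attained in `V_ζ`, then composing `k` with the restriction of
`j` to `V_ζ` shows that `j(β)` is one. Hence all iterates `j^n(κ)` stay below or at `λ`, and their
supremum is a fixed point of `j` strictly between `κ` and `δ` (`ordMap_iSup_eq`). Kunen's theorem
`ordMap_ne_of_lt` forbids this.

Kunen's theorem rests on an `ω`-Jónsson function `f` on the supposed fixed point
(`exists_omega_jonsson`). By elementarity `j(f)` has the same property in the target, where it is
applied to the injection given by `j` on ordinals: some sequence `t` of ordinals in the range of `j`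
has `j(f)(t) = κ`. Since `ω < κ`, `t = j(s)` for a sequence `s`, so `κ = j(f(s))`; but `κ` is not in
the range of `j`.

Restricting `j` requires that being some `V_β` is expressed by one formula in all levels
(`Defn.isLevel`); this gives `exists_restrict`. -/

theorem val_injective {α : Ordinal.{u}} :
    Function.Injective (fun x : RankStruct A α => x.val) :=
  Subtype.val_injective

theorem mem_of_mem {α : Ordinal.{u}} (x : RankStruct A α) {y : ZFSet.{u}} (h : y ∈ x.val) :
    y ∈ V_ α :=
  (ZFSet.isTransitive_vonNeumann α).subset_of_mem x.2 h

theorem mem_of_subset {α : Ordinal.{u}} (x : RankStruct A α) {y : ZFSet.{u}} (h : y ⊆ x.val) :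
    y ∈ V_ α :=
  ZFSet.mem_vonNeumann_of_subset h x.2

/-- A family of predicates on the structures `⟨V_α, ∈, A ∩ V_α⟩` that is defined by one formula. -/
def Defn (A : Class.{u}) {n : ℕ} (P : ∀ α : Ordinal.{u}, (Fin n → RankStruct A α) → Prop) : Prop :=
  ∃ φ : setPredLang.BoundedFormula Empty n,
    ∀ (α : Ordinal.{u}) (v : Fin n → RankStruct A α), φ.Realize default v ↔ P α v

namespace Defn

variable {n : ℕ} {P Q : ∀ α : Ordinal.{u}, (Fin n → RankStruct A α) → Prop}

theorem map (h : Defn A P) {α β : Ordinal.{u}} (j : RankStruct A α ↪ₑ[setPredLang] RankStruct A β)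
    (v : Fin n → RankStruct A α) : P β (j ∘ v) ↔ P α v := by
  obtain ⟨φ, hφ⟩ := h
  rw [← hφ, ← hφ, ← j.map_boundedFormula φ default v, Subsingleton.elim (j ∘ default) default]

theorem of_iff (h : Defn A P) (hPQ : ∀ α v, Q α v ↔ P α v) : Defn A Q := by
  obtain ⟨φ, hφ⟩ := h
  exact ⟨φ, fun α v => (hφ α v).trans (hPQ α v).symm⟩

theorem imp (hP : Defn A P) (hQ : Defn A Q) : Defn A fun α v => P α v → Q α v := by
  obtain ⟨φ, hφ⟩ := hP
  obtain ⟨ψ, hψ⟩ := hQ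
  exact ⟨φ.imp ψ, fun α v => by rw [BoundedFormula.realize_imp, hφ, hψ]⟩

theorem and (hP : Defn A P) (hQ : Defn A Q) : Defn A fun α v => P α v ∧ Q α v := by
  obtain ⟨φ, hφ⟩ := hP
  obtain ⟨ψ, hψ⟩ := hQ
  exact ⟨φ ⊓ ψ, fun α v => by rw [BoundedFormula.realize_inf, hφ, hψ]⟩

theorem or (hP : Defn A P) (hQ : Defn A Q) : Defn A fun α v => P α v ∨ Q α v := by
  obtain ⟨φ, hφ⟩ := hP
  obtain ⟨ψ, hψ⟩ := hQ
  exact ⟨φ ⊔ ψ, fun α v => by rw [BoundedFormula.realize_sup, hφ, hψ]⟩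

theorem iff (hP : Defn A P) (hQ : Defn A Q) : Defn A fun α v => (P α v ↔ Q α v) :=
  ((hP.imp hQ).and (hQ.imp hP)).of_iff fun _ _ => iff_iff_implies_and_implies

theorem all {R : ∀ α : Ordinal.{u}, (Fin n → RankStruct A α) → RankStruct A α → Prop}
    (h : Defn A (n := n + 1) fun α w => R α (fun i => w i.castSucc) (w (Fin.last n))) :
    Defn A fun α v => ∀ x, R α v x := by
  obtain ⟨φ, hφ⟩ := h
  exact ⟨φ.all, fun α v => by simp [BoundedFormula.realize_all, hφ]⟩

theorem ex {R : ∀ α : Ordinal.{u}, (Fin n → RankStruct A α) → RankStruct A α → Prop}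
    (h : Defn A (n := n + 1) fun α w => R α (fun i => w i.castSucc) (w (Fin.last n))) :
    Defn A fun α v => ∃ x, R α v x := by
  obtain ⟨φ, hφ⟩ := h
  exact ⟨φ.ex, fun α v => by simp [BoundedFormula.realize_ex, hφ]⟩

theorem mem (i k : Fin n) : Defn A fun _ v => (v i).val ∈ (v k).val :=
  ⟨.rel (L := setPredLang) SetPredRel.mem ![.var (.inr i), .var (.inr k)], fun _ _ => Iff.rfl⟩

theorem eq (i k : Fin n) : Defn A fun _ v => (v i).val = (v k).val :=
  ⟨.equal (.var (.inr i)) (.var (.inr k)), fun _ _ => val_injective.eq_iff.symm⟩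

theorem subset (i k : Fin n) : Defn A fun _ v => (v i).val ⊆ (v k).val := by
  have h : Defn A fun α v => ∀ x : RankStruct A α, x.val ∈ (v i).val → x.val ∈ (v k).val :=
    .all (.imp (.mem _ i.castSucc) (.mem _ k.castSucc))
  exact h.of_iff fun _ v => ⟨fun h x hx => h hx, fun h x hx => h ⟨x, (v i).mem_of_mem hx⟩ hx⟩

theorem eq_unorderedPair (i k l : Fin n) :
    Defn A fun _ v => (v i).val = {(v k).val, (v l).val} := by
  have h : Defn A fun α v => (v k).val ∈ (v i).val ∧ (v l).val ∈ (v i).val ∧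
      ∀ x : RankStruct A α, x.val ∈ (v i).val → x.val = (v k).val ∨ x.val = (v l).val :=
    .and (.mem k i) (.and (.mem l i) (.all (.imp (.mem _ i.castSucc)
      (.or (.eq _ k.castSucc) (.eq _ l.castSucc)))))
  refine h.of_iff fun _ v => ⟨fun h => by simp [h], ?_⟩
  rintro ⟨hk, hl, h⟩
  ext x
  rw [ZFSet.mem_pair]
  exact ⟨fun hx => h ⟨x, (v i).mem_of_mem hx⟩ hx, by rintro (rfl | rfl) <;> assumption⟩

theorem eq_pair (i k l : Fin n) :
    Defn A fun _ v => (v i).val = ZFSet.pair (v k).val (v l).val := by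
  have h : Defn A fun α v =>
      (∃ x : RankStruct A α, x.val ∈ (v i).val ∧ x.val = {(v k).val, (v k).val}) ∧
      (∃ x : RankStruct A α, x.val ∈ (v i).val ∧ x.val = {(v k).val, (v l).val}) ∧
      ∀ x : RankStruct A α, x.val ∈ (v i).val →
        x.val = {(v k).val, (v k).val} ∨ x.val = {(v k).val, (v l).val} :=
    .and (.ex (.and (.mem _ i.castSucc) (.eq_unorderedPair _ k.castSucc k.castSucc)))
      (.and (.ex (.and (.mem _ i.castSucc) (.eq_unorderedPair _ k.castSucc l.castSucc)))
        (.all (.imp (.mem _ i.castSucc) (.or (.eq_unorderedPair _ k.castSucc k.castSucc)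
          (.eq_unorderedPair _ k.castSucc l.castSucc)))))
  refine h.of_iff fun _ v => ?_
  simp only [ZFSet.pair, ZFSet.pair_eq_singleton]
  constructor
  · intro h
    refine ⟨⟨⟨{(v k).val}, (v i).mem_of_mem (by simp [h])⟩, by simp [h], rfl⟩,
      ⟨⟨{(v k).val, (v l).val}, (v i).mem_of_mem (by simp [h])⟩, by simp [h], rfl⟩,
      fun x hx => by simpa [h] using hx⟩
  · rintro ⟨⟨x, hx, hx'⟩, ⟨y, hy, hy'⟩, h⟩
    ext z
    rw [ZFSet.mem_pair]
    refine ⟨fun hz => h ⟨z, (v i).mem_of_mem hz⟩ hz, ?_⟩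
    rintro (rfl | rfl)
    · rwa [← hx']
    · rwa [← hy']

/-- `V_α` need not be closed under pairing, but a pair that belongs to an element of `V_α` is itself
in `V_α`. -/
theorem pair_mem (i k l : Fin n) :
    Defn A fun _ v => ZFSet.pair (v i).val (v k).val ∈ (v l).val := by
  have h : Defn A fun α v => ∃ x : RankStruct A α,
      x.val ∈ (v l).val ∧ x.val = ZFSet.pair (v i).val (v k).val :=
    .ex (.and (.mem _ l.castSucc) (.eq_pair _ i.castSucc k.castSucc))
  refine h.of_iff fun _ v => ?_
  exact ⟨fun h => ⟨⟨_, (v l).mem_of_mem h⟩, h, rfl⟩, fun ⟨x, hx, hx'⟩ => hx' ▸ hx⟩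

end Defn

/-! ### Restricting an embedding to a lower level. -/

section Relativize

variable {X : Type*}

/-- The relativization of a formula to the elements of an additional free variable. -/
def relativize : ∀ {n : ℕ}, setPredLang.BoundedFormula X n → setPredLang.BoundedFormula (Option X) n
  | _, .falsum => .falsum
  | _, .equal s t => .equal (s.relabel (Sum.map some id)) (t.relabel (Sum.map some id))
  | _, .rel R ts => .rel R fun i => (ts i).relabel (Sum.map some id)
  | _, .imp φ ψ => .imp (relativize φ) (relativize ψ)
  | n, .all φ => .all (.imp
      (.rel (L := setPredLang) SetPredRel.mem ![.var (.inr (Fin.last n)), .var (.inl none)])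
      (relativize φ))

/-- The inclusion of `V_α` in `V_β` for `α ≤ β`. -/
def incl {α β : Ordinal.{u}} (h : α ≤ β) (x : RankStruct A α) : RankStruct A β :=
  ⟨x.val, ZFSet.vonNeumann_subset_of_le h x.2⟩

theorem realize_relabel_incl {α β : Ordinal.{u}} (h : α ≤ β) (U : RankStruct A β) {n : ℕ}
    (t : setPredLang.Term (X ⊕ Fin n)) (v : X → RankStruct A α) (xs : Fin n → RankStruct A α) :
    (t.relabel (Sum.map some id)).realize
        (Sum.elim (fun o : Option X => o.elim U (incl h ∘ v)) (incl h ∘ xs)) =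
      incl h (t.realize (Sum.elim v xs)) := by
  cases t with
  | var i => cases i <;> rfl
  | func f _ => exact Empty.elim f

theorem relMap_incl {α β : Ordinal.{u}} (h : α ≤ β) {n : ℕ} (R : setPredLang.Relations n)
    (xs : Fin n → RankStruct A α) :
    Structure.RelMap R (fun i => incl h (xs i)) ↔ Structure.RelMap R xs := by
  cases R <;> exact Iff.rfl

/-- Quantifiers guarded by `U` range exactly over the image of `incl`, and `incl` preserves and
reflects both relations. -/
theorem realize_relativize {α β : Ordinal.{u}} (h : α ≤ β) (U : RankStruct A β)
    (hU : U.val = V_ α) {n : ℕ} (φ : setPredLang.BoundedFormula X n) (v : X → RankStruct A α)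
    (xs : Fin n → RankStruct A α) :
    (relativize φ).Realize (fun o : Option X => o.elim U (incl h ∘ v)) (incl h ∘ xs) ↔
      φ.Realize v xs := by
  induction φ with
  | falsum => exact Iff.rfl
  | equal s t =>
    simp only [relativize, BoundedFormula.Realize, realize_relabel_incl]
    exact ⟨fun e => val_injective (congrArg (fun x : RankStruct A β => x.val) e), fun e => e ▸ rfl⟩
  | rel R ts =>
    simp only [relativize, BoundedFormula.Realize, realize_relabel_incl]
    exact relMap_incl h R _
  | imp φ ψ hφ hψ => simp only [relativize, BoundedFormula.Realize, hφ, hψ]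
  | @all n φ hφ =>
    simp only [relativize, BoundedFormula.realize_all, BoundedFormula.realize_imp]
    have key : ∀ x : RankStruct A α, (Fin.snoc (incl h ∘ xs) (incl h x) : Fin (n + 1) → _) =
        incl h ∘ (Fin.snoc xs x : Fin (n + 1) → _) := fun x => (Fin.comp_snoc _ _ _).symm
    have hmem : ∀ x : RankStruct A β, ((BoundedFormula.rel (L := setPredLang) SetPredRel.mem
        ![.var (.inr (Fin.last n)), .var (.inl none)] :
          setPredLang.BoundedFormula (Option X) (n + 1)).Realize
        (fun o : Option X => o.elim U (incl h ∘ v)) (Fin.snoc (incl h ∘ xs) x)) ↔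
          x.val ∈ V_ α := by
      intro x
      rw [← hU]
      change ((Fin.snoc (incl h ∘ xs) x : Fin (n + 1) → RankStruct A β) (Fin.last n)).val ∈ U.val ↔ _
      rw [Fin.snoc_last]
    constructor
    · intro H x
      rw [← hφ, ← key]
      exact H _ ((hmem _).2 x.2)
    · intro H x hx
      obtain ⟨y, rfl⟩ : ∃ y, incl h y = x := ⟨⟨x.val, (hmem x).1 hx⟩, rfl⟩
      rw [key, hφ]
      exact H _

/-- An elementary embedding of `V_α` restricts to a level `V_β ∈ V_α` if the image of this level
is a level. -/
def restrict {α β γ δ : Ordinal.{u}} (j : RankStruct A α ↪ₑ[setPredLang] RankStruct A γ)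
    (U : RankStruct A α) (hU : U.val = V_ β) (hjU : (j U).val = V_ δ)
    (h : β ≤ α) (h' : δ ≤ γ) : RankStruct A β ↪ₑ[setPredLang] RankStruct A δ where
  toFun x := ⟨(j (incl h x)).val, by
    rw [← hjU]
    exact ((Defn.mem (0 : Fin 2) 1).map j ![incl h x, U]).2 (by
      change x.val ∈ U.val
      rw [hU]
      exact x.2)⟩
  map_formula' n φ x := by
    rw [Formula.Realize, Formula.Realize, ← realize_relativize h U hU,
      ← realize_relativize h' (j U) hjU, ← j.map_boundedFormula]
    refine iff_of_eq (congrArg₂ _ ?_ (Subsingleton.elim _ _))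
    funext o
    cases o <;> rfl

end Relativize

end RankStruct

/-! ### The Erdős–Hajnal theorem. -/

section Jonsson

/-- Two sequences are tail equivalent if they agree up to a shift and up to initial segments. -/
def tailSetoid (X : Type*) : Setoid (ℕ → X) where
  r s t := ∃ m n, ∀ k, s (m + k) = t (n + k)
  iseqv :=
    { refl := fun _ => ⟨0, 0, fun _ => rfl⟩
      symm := fun ⟨m, n, h⟩ => ⟨n, m, fun k => (h k).symm⟩
      trans := by
        rintro s t r ⟨m, n, h⟩ ⟨m', n', h'⟩
        refine ⟨m + m', n' + n, fun k => ?_⟩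
        rw [add_assoc, h, add_assoc, ← h']
        congr 1
        omega }

/-- Fix a representative of each tail class. A tail of `a` coincides with a tail of its
representative, and the value is the entry of the representative just before that tail. Injectivity
of `a` makes the position unique. -/
theorem exists_predecessor_function (X : Type*) [Nonempty X] :
    ∃ f : (ℕ → X) → X, ∀ a : ℕ → X, Function.Injective a →
      ∃ n, f (fun i => a (n + 1 + i)) = a n := by
  classical
  let rep : (ℕ → X) → (ℕ → X) := fun s => (Quotient.mk (tailSetoid X) s).out
  let f : (ℕ → X) → X := fun t =>
    if h : ∃ k, ∀ i, t i = rep t (k + 1 + i) then rep t h.choose else Classical.arbitrary X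
  refine ⟨f, fun a ha => ?_⟩
  obtain ⟨m, n, hr⟩ : ∃ m n, ∀ k, rep a (m + k) = a (n + k) :=
    Quotient.exact (s := tailSetoid X) (Quotient.out_eq (Quotient.mk (tailSetoid X) a))
  refine ⟨n, ?_⟩
  set t : ℕ → X := fun i => a (n + 1 + i) with ht
  have hrep : rep t = rep a := by
    refine congrArg Quotient.out (Quotient.sound (s := tailSetoid X) ⟨0, n + 1, fun k => ?_⟩)
    simp [ht]
  have hshift : ∀ i, t i = rep a (m + 1 + i) := fun i => by
    rw [add_assoc, hr, ← add_assoc]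
  have hex : ∃ k, ∀ i, t i = rep t (k + 1 + i) := ⟨m, fun i => by rw [hrep, hshift]⟩
  have hf : f t = rep t hex.choose := dif_pos hex
  have hk := hex.choose_spec
  generalize hex.choose = k at hf hk
  rw [hrep] at hf hk
  have hkm : k = m := by
    rcases lt_trichotomy k m with h | h | h
    · obtain ⟨d, rfl⟩ := Nat.exists_eq_add_of_lt h
      have h1 := hk (d + 1)
      have h2 := hshift 0
      rw [show k + 1 + (d + 1) = k + d + 1 + 1 + 0 by omega, ← h2] at h1
      have := ha h1
      omega
    · exact h
    · obtain ⟨d, rfl⟩ := Nat.exists_eq_add_of_lt h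
      have h1 := hshift (d + 1)
      have h2 := hk 0
      rw [show m + 1 + (d + 1) = m + d + 1 + 1 + 0 by omega, ← h2] at h1
      have := ha h1
      omega
  rw [hf, hkm]
  exact hr 0

theorem exists_injective_notMem_range {X : Type*} [Infinite X] (x : X) :
    ∃ p : X → X, Function.Injective p ∧ x ∉ Set.range p := by
  have h : Cardinal.mk ({x}ᶜ : Set X) = Cardinal.mk X := by
    refine Cardinal.mk_compl_of_infinite _ ?_
    rw [Cardinal.mk_singleton]
    exact Cardinal.one_lt_aleph0.trans_le (Cardinal.aleph0_le_mk X)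
  obtain ⟨e⟩ := Cardinal.eq.1 h.symm
  refine ⟨fun y => (e y).1, Subtype.val_injective.comp e.injective, ?_⟩
  rintro ⟨y, hy⟩
  exact (e y).2 hy

/-- The Erdős–Hajnal theorem on `ω`-Jónsson functions, for injections in place of subsets of full
cardinality. -/
theorem exists_omega_jonsson (X : Type*) [Infinite X] :
    ∃ F : (ℕ → X) → X, ∀ g : X → X, Function.Injective g → ∀ a, ∃ s : ℕ → X, F (g ∘ s) = a := by
  obtain ⟨f, hf⟩ := exists_predecessor_function X
  -- It is enough that `f` works on sequences from the range of some injection `e`; this is then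
  -- transported back along `e`.
  suffices h : ∃ e : X → X, Function.Injective e ∧ ∀ h : X → X, Function.Injective h →
      ∀ x, ∃ s : ℕ → X, f (e ∘ h ∘ s) = e x by
    obtain ⟨e, he, H⟩ := h
    refine ⟨fun s => Function.invFun e (f (e ∘ s)), fun g hg a => ?_⟩
    obtain ⟨s, hs⟩ := H g hg a
    exact ⟨s, (congrArg (Function.invFun e) hs).trans (Function.leftInverse_invFun he a)⟩
  by_contra! H
  -- The omitted value can be taken outside the range of `h`: otherwise shrink `h` so that it misses
  -- this point.
  have step : ∀ e : {e : X → X // Function.Injective e}, ∃ h : {h : X → X // Function.Injective h},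
      ∃ x, x ∉ Set.range h.1 ∧ ∀ s : ℕ → X, f (e.1 ∘ h.1 ∘ s) ≠ e.1 x := by
    intro e
    obtain ⟨h, hh, x, hx⟩ := H e.1 e.2
    by_cases hxr : x ∈ Set.range h
    · obtain ⟨y, rfl⟩ := hxr
      obtain ⟨p, hp, hyp⟩ := exists_injective_notMem_range y
      refine ⟨⟨h ∘ p, hh.comp hp⟩, h y, ?_, fun s => hx (p ∘ s)⟩
      rintro ⟨z, hz⟩
      exact hyp ⟨z, hh hz⟩
    · exact ⟨⟨h, hh⟩, x, hxr, hx⟩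
  choose h x hxr hx using step
  let e : ℕ → {e : X → X // Function.Injective e} := fun n =>
    Nat.rec ⟨id, Function.injective_id⟩ (fun _ e => ⟨e.1 ∘ (h e).1, e.2.comp (h e).2⟩) n
  have he : ∀ n, (e (n + 1)).1 = (e n).1 ∘ (h (e n)).1 := fun _ => rfl
  let a : ℕ → X := fun n => (e n).1 (x (e n))
  have hanti : ∀ n k, Set.range (e (n + k)).1 ⊆ Set.range (e n).1 := by
    intro n k
    induction k with
    | zero => exact subset_rfl
    | succ k ih =>
      rw [← add_assoc, he]
      exact (Set.range_comp_subset_range _ _).trans ih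
  have ha : ∀ n k, a (n + 1 + k) ∈ Set.range (e (n + 1)).1 := fun n k => hanti (n + 1) k ⟨_, rfl⟩
  have hnot : ∀ n, a n ∉ Set.range (e (n + 1)).1 := by
    rintro n ⟨y, hy⟩
    exact hxr (e n) ⟨y, (e n).2 hy⟩
  have hne : ∀ m n, m < n → a m ≠ a n := by
    intro m n hmn heq
    obtain ⟨k, rfl⟩ := Nat.exists_eq_add_of_lt hmn
    refine hnot m (heq ▸ ?_)
    rw [show m + k + 1 = m + 1 + k by omega]
    exact ha m k
  have hinj : Function.Injective a := fun m n hmn => by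
    rcases lt_trichotomy m n with h | h | h
    · exact absurd hmn (hne _ _ h)
    · exact h
    · exact absurd hmn.symm (hne _ _ h)
  -- All later terms of `a` lie in the range of `e (n + 1)`, so `f` takes the value `a n` on a
  -- sequence from that range, against the choice of `a n`.
  obtain ⟨n, hn⟩ := hf a hinj
  choose s hs using ha n
  refine hx (e n) s ?_
  rw [← Function.comp_assoc, ← he]
  exact (congrArg f (funext hs)).trans hn

end Jonsson

open Ordinal

/-! ### Definability of ordinals and levels. -/

namespace RankStruct

variable {A : Class.{u}}

namespace Defn

variable {n : ℕ}

theorem isTransitive (i : Fin n) : Defn A fun _ v => (v i).val.IsTransitive := by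
  have h : Defn A fun α v => ∀ x : RankStruct A α, x.val ∈ (v i).val → x.val ⊆ (v i).val :=
    .all (.imp (.mem _ i.castSucc) (.subset _ i.castSucc))
  exact h.of_iff fun _ v => ⟨fun h x hx => h _ hx, fun h x hx => h ⟨x, (v i).mem_of_mem hx⟩ hx⟩

theorem isOrdinal (i : Fin n) : Defn A fun _ v => (v i).val.IsOrdinal := by
  have h : Defn A fun α v => (v i).val.IsTransitive ∧
      ∀ x : RankStruct A α, x.val ∈ (v i).val → x.val.IsTransitive :=
    .and (.isTransitive i) (.all (.imp (.mem _ i.castSucc) (.isTransitive _)))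
  refine h.of_iff fun _ v => ?_
  rw [ZFSet.isOrdinal_iff_forall_mem_isTransitive]
  exact and_congr_right fun _ =>
    ⟨fun h x hx => h _ hx, fun h x hx => h ⟨x, (v i).mem_of_mem hx⟩ hx⟩

end Defn

/-- If `x` has smaller rank than `w`, its rank is at most that of some `y ∈ w`; a level including
`y` then includes `x`. -/
theorem eq_vonNeumann_rank {w : ZFSet.{u}} {B : Set ZFSet.{u}}
    (hB : ∀ b ∈ B, ∃ γ : Ordinal.{u}, b = V_ γ) (hw : ∀ x, x ∈ w ↔ ∃ b ∈ B, x ⊆ b) :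
    w = V_ w.rank := by
  ext x
  rw [ZFSet.mem_vonNeumann]
  refine ⟨ZFSet.rank_lt_of_mem, fun h => ?_⟩
  obtain ⟨y, hy, hxy⟩ := ZFSet.lt_rank_iff.1 h
  obtain ⟨b, hb, hyb⟩ := (hw y).1 hy
  obtain ⟨γ, rfl⟩ := hB b hb
  exact (hw x).2 ⟨_, hb, ZFSet.subset_vonNeumann.2 (hxy.trans (ZFSet.subset_vonNeumann.1 hyb))⟩

/-- The witness `h` is a history: each of its members is determined by the members of `h` below it,
so all of them are levels by `∈`-induction. For `V_β` the history `{V_γ | γ < β}` has rank at most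
`β`, hence lies in every `V_α` containing `V_β`, even for successor `α`. -/
theorem Defn.isLevel {n : ℕ} (i : Fin n) :
    Defn A fun _ v => ∃ β : Ordinal.{u}, (v i).val = V_ β := by
  have h : Defn A fun α v => ∃ h : RankStruct A α,
      (∀ w : RankStruct A α, w.val ∈ h.val → ∀ x : RankStruct A α, x.val ∈ w.val ↔
        ∃ b : RankStruct A α, b.val ∈ h.val ∧ b.val ∈ w.val ∧ x.val ⊆ b.val) ∧
      ∀ x : RankStruct A α, x.val ∈ (v i).val ↔
        ∃ b : RankStruct A α, b.val ∈ h.val ∧ x.val ⊆ b.val :=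
    .ex (.and
      (.all (.imp (.mem _ (Fin.last n).castSucc)
        (.all (.iff (.mem _ (Fin.last (n + 1)).castSucc)
          (.ex (.and (.mem _ (Fin.last n).castSucc.castSucc.castSucc)
            (.and (.mem _ (Fin.last (n + 1)).castSucc.castSucc)
              (.subset (Fin.last (n + 2)).castSucc _))))))))
      (.all (.iff (.mem _ i.castSucc.castSucc)
        (.ex (.and (.mem _ (Fin.last n).castSucc.castSucc)
          (.subset (Fin.last (n + 1)).castSucc _))))))
  refine h.of_iff fun α v => ⟨?_, ?_⟩
  · rintro ⟨β, hβ⟩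
    have hlt : β < α := by
      have := (v i).2
      rwa [hβ, ZFSet.vonNeumann_mem_vonNeumann_iff] at this
    let f : Set.Iio β → ZFSet.{u} := fun γ => V_ γ.1
    have hr : (ZFSet.range f).rank ≤ β := by
      rw [ZFSet.rank_le_iff]
      intro y hy
      obtain ⟨γ, rfl⟩ := ZFSet.mem_range.1 hy
      rw [ZFSet.rank_vonNeumann]
      exact γ.2
    refine ⟨⟨ZFSet.range f, ZFSet.mem_vonNeumann.2 (hr.trans_lt hlt)⟩, ?_, ?_⟩
    · intro w hw x
      obtain ⟨γ, hγ⟩ := ZFSet.mem_range.1 hw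
      rw [← hγ, ZFSet.mem_vonNeumann']
      constructor
      · rintro ⟨η, hη, hx⟩
        exact ⟨⟨V_ η, ZFSet.vonNeumann_mem_of_lt ((hη.trans γ.2).trans hlt)⟩,
          ZFSet.mem_range.2 ⟨⟨η, hη.trans γ.2⟩, rfl⟩, ZFSet.vonNeumann_mem_of_lt hη, hx⟩
      · rintro ⟨b, hb, hbw, hx⟩
        obtain ⟨η, hη⟩ := ZFSet.mem_range.1 hb
        rw [← hη] at hbw hx
        exact ⟨η, ZFSet.vonNeumann_mem_vonNeumann_iff.1 hbw, hx⟩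
    · intro x
      rw [hβ, ZFSet.mem_vonNeumann']
      constructor
      · rintro ⟨η, hη, hx⟩
        exact ⟨⟨V_ η, ZFSet.vonNeumann_mem_of_lt (hη.trans hlt)⟩,
          ZFSet.mem_range.2 ⟨⟨η, hη⟩, rfl⟩, hx⟩
      · rintro ⟨b, hb, hx⟩
        obtain ⟨η, hη⟩ := ZFSet.mem_range.1 hb
        rw [← hη] at hx
        exact ⟨η, η.2, hx⟩
  · rintro ⟨h, hh, hU⟩
    have hlev : ∀ w, w ∈ h.val → ∃ γ : Ordinal.{u}, w = V_ γ := by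
      intro w
      induction w using ZFSet.inductionOn with
      | _ w ih =>
        intro hw
        refine ⟨_, eq_vonNeumann_rank (B := {b | b ∈ h.val ∧ b ∈ w})
          (fun b hb => ih b hb.2 hb.1) fun x => ⟨fun hx => ?_, ?_⟩⟩
        · obtain ⟨b, hb, hbw, hxb⟩ :=
            (hh ⟨w, h.mem_of_mem hw⟩ hw ⟨x, mem_of_mem (A := A) ⟨w, h.mem_of_mem hw⟩ hx⟩).1 hx
          exact ⟨b.val, ⟨hb, hbw⟩, hxb⟩
        · rintro ⟨b, ⟨hb, hbw⟩, hxb⟩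
          have hbV := h.mem_of_mem hb
          exact (hh ⟨w, h.mem_of_mem hw⟩ hw ⟨x, mem_of_subset (A := A) ⟨b, hbV⟩ hxb⟩).2
            ⟨⟨b, hbV⟩, hb, hbw, hxb⟩
    refine ⟨_, eq_vonNeumann_rank (B := {b | b ∈ h.val}) hlev fun x => ⟨fun hx => ?_, ?_⟩⟩
    · obtain ⟨b, hb, hxb⟩ := (hU ⟨x, (v i).mem_of_mem hx⟩).1 hx
      exact ⟨b.val, hb, hxb⟩
    · rintro ⟨b, hb, hxb⟩
      exact (hU ⟨x, mem_of_subset (A := A) ⟨b, h.mem_of_mem hb⟩ hxb⟩).2 ⟨⟨b, h.mem_of_mem hb⟩, hb, hxb⟩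

/-! ### Action on ordinals and the critical point. -/

section Embedding

variable {α γ : Ordinal.{u}} (j : RankStruct A α ↪ₑ[setPredLang] RankStruct A γ)

theorem map_mem_iff (x y : RankStruct A α) : (j x).val ∈ (j y).val ↔ x.val ∈ y.val :=
  (Defn.mem (0 : Fin 2) 1).map j ![x, y]

theorem map_isOrdinal {x : RankStruct A α} (h : x.val.IsOrdinal) : (j x).val.IsOrdinal :=
  ((Defn.isOrdinal (0 : Fin 1)).map j ![x]).2 h

open Classical in
/-- The action of an elementary embedding on ordinals. -/
noncomputable def ordMap (β : Ordinal.{u}) : Ordinal.{u} :=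
  if h : β < α then (j (ofOrdinal A h)).val.rank else 0

variable {j}

theorem val_map_ofOrdinal {β : Ordinal.{u}} (h : β < α) :
    (j (ofOrdinal A h)).val = (ordMap j β).toZFSet := by
  rw [ordMap, dif_pos h]
  exact (map_isOrdinal j (ZFSet.isOrdinal_toZFSet β)).toZFSet_rank_eq.symm

theorem val_map_of_val_eq {β : Ordinal.{u}} {x : RankStruct A α} (hx : x.val = β.toZFSet) :
    (j x).val = (ordMap j β).toZFSet := by
  have h : β < α := by
    have := x.2
    rwa [hx, ZFSet.mem_vonNeumann, rank_toZFSet] at this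
  rw [← val_map_ofOrdinal h]
  exact congrArg (fun x => (j x).val) (val_injective hx)

theorem ordMap_lt {β : Ordinal.{u}} (h : β < α) : ordMap j β < γ := by
  have := (j (ofOrdinal A h)).2
  rwa [val_map_ofOrdinal, ZFSet.mem_vonNeumann, rank_toZFSet] at this

theorem ordMap_lt_ordMap {β β' : Ordinal.{u}} (h : β < β') (h' : β' < α) :
    ordMap j β < ordMap j β' := by
  rw [← toZFSet_mem_toZFSet_iff, ← val_map_ofOrdinal h', ← val_map_ofOrdinal (h.trans h'),
    map_mem_iff]
  exact toZFSet_mem_toZFSet_iff.2 h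

theorem ordMap_injOn : Set.InjOn (ordMap j) (Set.Iio α) :=
  StrictMonoOn.injOn fun _ _ _ h' h => ordMap_lt_ordMap h h'

theorem le_ordMap {β : Ordinal.{u}} (h : β < α) : β ≤ ordMap j β := by
  induction β using WellFoundedLT.induction with
  | _ β ih =>
    by_contra! hlt
    exact (ih _ hlt (hlt.trans h)).not_gt (ordMap_lt_ordMap hlt h)

theorem isCriticalPoint_iff {κ : Ordinal.{u}} :
    IsCriticalPoint j κ ↔ κ < α ∧ ordMap j κ ≠ κ ∧ ∀ β < κ, ordMap j β = β := by
  constructor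
  · rintro ⟨hκ, hne, hlt⟩
    refine ⟨hκ, fun h => hne (by rw [val_map_ofOrdinal, h]), fun β hβ => ?_⟩
    have := hlt β hβ
    rwa [val_map_ofOrdinal, toZFSet_injective.eq_iff] at this
  · rintro ⟨hκ, hne, hlt⟩
    refine ⟨hκ, fun h => hne ?_, fun β hβ => by rw [val_map_ofOrdinal, hlt β hβ]⟩
    rwa [val_map_ofOrdinal, toZFSet_injective.eq_iff] at h

theorem _root_.IsCriticalPoint.lt {κ : Ordinal.{u}} (h : IsCriticalPoint j κ) : κ < α :=
  (isCriticalPoint_iff.1 h).1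

theorem _root_.IsCriticalPoint.ordMap_eq {κ β : Ordinal.{u}} (h : IsCriticalPoint j κ)
    (hβ : β < κ) : ordMap j β = β :=
  (isCriticalPoint_iff.1 h).2.2 β hβ

theorem _root_.IsCriticalPoint.lt_ordMap {κ : Ordinal.{u}} (h : IsCriticalPoint j κ) :
    κ < ordMap j κ :=
  (le_ordMap h.lt).lt_of_ne (isCriticalPoint_iff.1 h).2.1.symm

/-- Ordinals below `κ` are fixed, and all others are sent above `κ`. -/
theorem _root_.IsCriticalPoint.ordMap_ne {κ β : Ordinal.{u}} (h : IsCriticalPoint j κ)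
    (hβ : β < α) : ordMap j β ≠ κ := by
  rcases lt_or_ge β κ with hlt | hge
  · rw [h.ordMap_eq hlt]
    exact hlt.ne
  · rcases hge.eq_or_lt with rfl | hlt
    · exact h.lt_ordMap.ne'
    · exact (hlt.trans_le (le_ordMap hβ)).ne'

/-- Here `κ ∈ j(κ)`, which contradicts elementarity if `κ` is zero or a successor. If `κ = ω`, every
nonempty element of `j(κ)` has a greatest element, but `κ` itself has none. -/
theorem _root_.IsCriticalPoint.omega0_lt {κ : Ordinal.{u}} (h : IsCriticalPoint j κ) : ω < κ := by
  have hmem : κ.toZFSet ∈ (j (ofOrdinal A h.lt)).val := by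
    rw [val_map_ofOrdinal, toZFSet_mem_toZFSet_iff]
    exact h.lt_ordMap
  have hγ := (mem_of_mem _ hmem)
  rcases zero_or_succ_or_isSuccLimit κ with h0 | ⟨n, hn⟩ | hlim
  · have hD : Defn A (n := 1) fun α v => ∃ x : RankStruct A α, x.val ∈ (v 0).val :=
      .ex (.mem _ (Fin.castSucc 0))
    obtain ⟨x, hx⟩ := (hD.map j ![ofOrdinal A h.lt]).1 ⟨⟨_, hγ⟩, hmem⟩
    change x.val ∈ κ.toZFSet at hx
    rw [h0, toZFSet_zero] at hx
    exact absurd hx (ZFSet.notMem_empty _)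
  · have hnκ : n < κ := by rw [← hn]; exact Order.lt_succ n
    have hD : Defn A (n := 2) fun α v => ∀ x : RankStruct A α, x.val ∈ (v 0).val →
        x.val ∈ (v 1).val ∨ x.val = (v 1).val :=
      .all (.imp (.mem _ (Fin.castSucc 0)) (.or (.mem _ (Fin.castSucc 1)) (.eq _ (Fin.castSucc 1))))
    have := (hD.map j ![ofOrdinal A h.lt, ofOrdinal A (hnκ.trans h.lt)]).2 (by
      intro x hx
      change x.val ∈ κ.toZFSet at hx
      change x.val ∈ n.toZFSet ∨ x.val = n.toZFSet
      rwa [← hn, Order.succ_eq_add_one, toZFSet_add_one, ZFSet.mem_insert_iff, or_comm] at hx)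
    have := this ⟨_, hγ⟩ hmem
    change κ.toZFSet ∈ (j (ofOrdinal A (hnκ.trans h.lt))).val ∨
      κ.toZFSet = (j (ofOrdinal A (hnκ.trans h.lt))).val at this
    rw [val_map_ofOrdinal, h.ordMap_eq hnκ, toZFSet_mem_toZFSet_iff,
      toZFSet_injective.eq_iff] at this
    rcases this with h1 | h1
    · exact absurd h1 hnκ.not_gt
    · exact absurd h1 hnκ.ne'
  · refine (omega0_le_of_isSuccLimit hlim).lt_of_ne ?_
    intro hω
    have hD : Defn A (n := 1) fun α v => ∀ y : RankStruct A α, y.val ∈ (v 0).val →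
        (∃ x : RankStruct A α, x.val ∈ y.val) →
        ∃ z : RankStruct A α, z.val ∈ y.val ∧
          ∀ x : RankStruct A α, x.val ∈ y.val → x.val ∈ z.val ∨ x.val = z.val :=
      .all (.imp (.mem _ (Fin.castSucc 0)) (.imp (.ex (.mem _ (Fin.castSucc 1)))
        (.ex (.and (.mem _ (Fin.castSucc 1))
          (.all (.imp (.mem _ (Fin.castSucc (Fin.castSucc 1)))
            (.or (.mem _ (Fin.castSucc 2)) (.eq _ (Fin.castSucc 2)))))))))
    have := (hD.map j ![ofOrdinal A h.lt]).2 (by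
      rintro y hy ⟨x, hx⟩
      change y.val ∈ κ.toZFSet at hy
      rw [← hω] at hy
      obtain ⟨a, ha, hay⟩ := mem_toZFSet_iff.1 hy
      obtain ⟨n, rfl⟩ := lt_omega0.1 ha
      cases n with
      | zero => rw [← hay, Nat.cast_zero, toZFSet_zero] at hx; exact absurd hx (ZFSet.notMem_empty _)
      | succ n =>
        rw [Nat.cast_succ, toZFSet_add_one] at hay
        refine ⟨⟨_, y.mem_of_mem (y := (n : Ordinal.{u}).toZFSet) (by simp [← hay])⟩,
          by simp [← hay], fun x hx => ?_⟩
        rw [← hay, ZFSet.mem_insert_iff] at hx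
        exact hx.symm)
    obtain ⟨z, hz, hmax⟩ := this ⟨_, hγ⟩ hmem ⟨⟨(0 : Ordinal.{u}).toZFSet,
      mem_of_mem (A := A) ⟨_, hγ⟩ (toZFSet_mem_toZFSet_iff.2 hlim.bot_lt)⟩,
      toZFSet_mem_toZFSet_iff.2 hlim.bot_lt⟩
    obtain ⟨b, hb, hbz⟩ := mem_toZFSet_iff.1 hz
    have hsucc := toZFSet_mem_toZFSet_iff.2 (hlim.succ_lt hb)
    have := hmax ⟨_, mem_of_mem (A := A) ⟨_, hγ⟩ hsucc⟩ hsucc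
    rw [← hbz] at this
    change (Order.succ b).toZFSet ∈ b.toZFSet ∨ (Order.succ b).toZFSet = b.toZFSet at this
    rw [toZFSet_mem_toZFSet_iff, toZFSet_injective.eq_iff] at this
    rcases this with h1 | h1
    · exact absurd h1 (Order.lt_succ b).not_gt
    · exact absurd h1 (Order.lt_succ b).ne'

theorem exists_restrict (j : RankStruct A α ↪ₑ[setPredLang] RankStruct A γ) {β : Ordinal.{u}}
    (h : β < α) :
    ∃ (δ : Ordinal.{u}) (k : RankStruct A β ↪ₑ[setPredLang] RankStruct A δ),
      ∀ η < β, ordMap k η = ordMap j η := by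
  let U : RankStruct A α := ⟨V_ β, ZFSet.vonNeumann_mem_of_lt h⟩
  obtain ⟨δ, hδ⟩ := ((Defn.isLevel (0 : Fin 1)).map j ![U]).2 ⟨β, rfl⟩
  change (j U).val = V_ δ at hδ
  have hδγ : δ ≤ γ := by
    have := (j U).2
    rw [hδ, ZFSet.vonNeumann_mem_vonNeumann_iff] at this
    exact this.le
  refine ⟨δ, restrict j U rfl hδ h.le hδγ, fun η hη => ?_⟩
  rw [← toZFSet_injective.eq_iff, ← val_map_ofOrdinal hη, ← val_map_ofOrdinal (hη.trans h)]
  rfl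

theorem ordMap_comp {δ : Ordinal.{u}} (k : RankStruct A γ ↪ₑ[setPredLang] RankStruct A δ)
    {β : Ordinal.{u}} (h : β < α) : ordMap (k.comp j) β = ordMap k (ordMap j β) := by
  rw [← toZFSet_injective.eq_iff, ← val_map_ofOrdinal h]
  exact val_map_of_val_eq (val_map_ofOrdinal h)

end Embedding

end RankStruct

/-! ### Sequences of ordinals as sets. -/

section Coding

theorem ZFSet.rank_orderedPair_lt {x y : ZFSet.{u}} {μ : Ordinal.{u}} (hx : x.rank < μ)
    (hy : y.rank < μ) : (ZFSet.pair x y).rank < Order.succ (Order.succ μ) := by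
  rw [ZFSet.pair, ZFSet.rank_pair, ZFSet.rank_singleton, ZFSet.rank_pair, max_lt_iff]
  have hx' := Order.succ_le_of_lt hx
  have hy' := Order.succ_le_of_lt hy
  simp only [Order.lt_succ_iff]
  exact ⟨Order.succ_le_succ hx', Order.succ_le_succ (max_le hx' hy')⟩

theorem ZFSet.rank_range_le {X : Type*} [Small.{u} X] {f : X → ZFSet.{u}} {μ : Ordinal.{u}}
    (h : ∀ x, (f x).rank < μ) : (ZFSet.range f).rank ≤ μ := by
  rw [ZFSet.rank_le_iff]
  intro y hy
  obtain ⟨x, rfl⟩ := ZFSet.mem_range.1 hy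
  exact h x

/-- The set coding a sequence of ordinals. -/
noncomputable def codeSeq (s : ℕ → Ordinal.{u}) : ZFSet.{u} :=
  ZFSet.range fun n : ℕ => ZFSet.pair (n : Ordinal.{u}).toZFSet (s n).toZFSet

theorem pair_mem_codeSeq {s : ℕ → Ordinal.{u}} {n : ℕ} {y : ZFSet.{u}} :
    ZFSet.pair (n : Ordinal.{u}).toZFSet y ∈ codeSeq s ↔ y = (s n).toZFSet := by
  rw [codeSeq, ZFSet.mem_range]
  constructor
  · rintro ⟨m, hm⟩
    rw [ZFSet.pair_inj, toZFSet_injective.eq_iff, Nat.cast_inj] at hm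
    obtain ⟨rfl, rfl⟩ := hm
    rfl
  · rintro rfl
    exact ⟨n, rfl⟩

theorem codeSeq_injective : Function.Injective codeSeq.{u} := by
  intro s t h
  funext n
  exact toZFSet_injective (pair_mem_codeSeq.1 (h ▸ pair_mem_codeSeq.2 rfl))

theorem rank_codeSeq_le {s : ℕ → Ordinal.{u}} {μ : Ordinal.{u}} (hμ : ω ≤ μ) (hs : ∀ n, s n < μ) :
    (codeSeq s).rank ≤ Order.succ (Order.succ μ) := by
  refine ZFSet.rank_range_le fun n => ZFSet.rank_orderedPair_lt ?_ ?_
  · rw [rank_toZFSet]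
    exact (natCast_lt_omega0 n).trans_le hμ
  · rw [rank_toZFSet]
    exact hs n

/-- The set `t` is a function from `w` to `m`. -/
def IsSeq (t w m : ZFSet.{u}) : Prop :=
  (∀ p ∈ t, ∃ n ∈ w, ∃ y ∈ m, p = ZFSet.pair n y) ∧
    ∀ n ∈ w, ∃ y ∈ m, ∀ z ∈ m, ZFSet.pair n z ∈ t ↔ z = y

theorem isSeq_iff {t : ZFSet.{u}} {μ : Ordinal.{u}} :
    IsSeq t (toZFSet ω) μ.toZFSet ↔ ∃ s : ℕ → Ordinal.{u}, (∀ n, s n < μ) ∧ t = codeSeq s := by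
  have hn : ∀ n : ℕ, (n : Ordinal.{u}).toZFSet ∈ toZFSet ω := fun n =>
    toZFSet_mem_toZFSet_iff.2 (natCast_lt_omega0 n)
  constructor
  · rintro ⟨h1, h2⟩
    have h3 : ∀ n : ℕ, ∃ a < μ, ∀ z ∈ μ.toZFSet,
        ZFSet.pair (n : Ordinal.{u}).toZFSet z ∈ t ↔ z = a.toZFSet := by
      intro n
      obtain ⟨y, hy, hyt⟩ := h2 _ (hn n)
      obtain ⟨a, ha, rfl⟩ := mem_toZFSet_iff.1 hy
      exact ⟨a, ha, hyt⟩
    choose s hs hst using h3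
    refine ⟨s, hs, ?_⟩
    ext p
    constructor
    · intro hp
      obtain ⟨_, hm, y, hy, rfl⟩ := h1 p hp
      obtain ⟨m, hm', rfl⟩ := mem_toZFSet_iff.1 hm
      obtain ⟨n, rfl⟩ := lt_omega0.1 hm'
      rw [pair_mem_codeSeq]
      exact (hst n y hy).1 hp
    · intro hp
      obtain ⟨n, rfl⟩ := ZFSet.mem_range.1 hp
      exact (hst n _ (toZFSet_mem_toZFSet_iff.2 (hs n))).2 rfl
  · rintro ⟨s, hs, rfl⟩
    have hsμ : ∀ n, (s n).toZFSet ∈ μ.toZFSet := fun n => toZFSet_mem_toZFSet_iff.2 (hs n)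
    constructor
    · intro p hp
      obtain ⟨n, rfl⟩ := ZFSet.mem_range.1 hp
      exact ⟨_, hn n, _, hsμ n, rfl⟩
    · intro m hm
      obtain ⟨m, hm', rfl⟩ := mem_toZFSet_iff.1 hm
      obtain ⟨n, rfl⟩ := lt_omega0.1 hm'
      exact ⟨_, hsμ n, fun z _ => pair_mem_codeSeq⟩

end Coding

/-! ### Jónsson functions inside a level. -/

namespace RankStruct

variable {A : Class.{u}}

namespace Defn

variable {n : ℕ}

theorem ball {R : ∀ α : Ordinal.{u}, (Fin n → RankStruct A α) → ZFSet.{u} → Prop} (i : Fin n)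
    (h : Defn A (n := n + 1) fun α w => R α (fun i => w i.castSucc) (w (Fin.last n)).val) :
    Defn A fun α v => ∀ x ∈ (v i).val, R α v x := by
  have h' : Defn A fun α v => ∀ x : RankStruct A α, x.val ∈ (v i).val → R α v x.val :=
    .all (.imp (.mem _ i.castSucc) h)
  exact h'.of_iff fun _ v => ⟨fun h x hx => h _ hx, fun h x hx => h ⟨x, (v i).mem_of_mem hx⟩ hx⟩

theorem bex {R : ∀ α : Ordinal.{u}, (Fin n → RankStruct A α) → ZFSet.{u} → Prop} (i : Fin n)
    (h : Defn A (n := n + 1) fun α w => R α (fun i => w i.castSucc) (w (Fin.last n)).val) :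
    Defn A fun α v => ∃ x ∈ (v i).val, R α v x := by
  have h' : Defn A fun α v => ∃ x : RankStruct A α, x.val ∈ (v i).val ∧ R α v x.val :=
    .ex (.and (.mem _ i.castSucc) h)
  exact h'.of_iff fun _ v => ⟨fun ⟨x, hx, h⟩ => ⟨⟨x, (v i).mem_of_mem hx⟩, hx, h⟩,
    fun ⟨x, hx, h⟩ => ⟨_, hx, h⟩⟩

theorem isSeq (i k l : Fin n) : Defn A fun _ v => IsSeq (v i).val (v k).val (v l).val :=
  .and
    (.ball i (.bex k.castSucc (.bex l.castSucc.castSucc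
      (.eq_pair (Fin.last n).castSucc.castSucc (Fin.last (n + 1)).castSucc _))))
    (.ball k (.bex l.castSucc (.ball l.castSucc.castSucc
      (.iff (.pair_mem (Fin.last n).castSucc.castSucc _ i.castSucc.castSucc.castSucc)
        (.eq _ (Fin.last (n + 1)).castSucc)))))

end Defn

/-- In the structure `⟨V_α, ∈, A ∩ V_α⟩`, the set `f` is a partial function on the functions from
`w` to `l` that takes all values in `l` on the sequences in the range of any injection of `l`. -/
def IsJonsson {α : Ordinal.{u}} (f w l : RankStruct A α) : Prop :=
  (∀ t a b : RankStruct A α, ZFSet.pair t.val a.val ∈ f.val → ZFSet.pair t.val b.val ∈ f.val →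
    a.val = b.val) ∧
  ∀ g : RankStruct A α,
    (∀ x ∈ l.val, ∃ y ∈ l.val, ZFSet.pair x y ∈ g.val) →
    (∀ x ∈ l.val, ∀ x' ∈ l.val, ∀ y ∈ l.val,
      ZFSet.pair x y ∈ g.val → ZFSet.pair x' y ∈ g.val → x = x') →
    ∀ a ∈ l.val, ∃ t : RankStruct A α, IsSeq t.val w.val l.val ∧
      (∀ n ∈ w.val, ∀ y ∈ l.val, ZFSet.pair n y ∈ t.val → ∃ x ∈ l.val, ZFSet.pair x y ∈ g.val) ∧
      ZFSet.pair t.val a ∈ f.val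

/-- Indices `0`, `1`, `2` are the parameters; each nested quantifier takes the next free index. -/
theorem Defn.isJonsson : Defn A fun _ (v : Fin 3 → _) => IsJonsson (v 0) (v 1) (v 2) :=
  .and
    (.all (.all (.all (.imp (.pair_mem 3 4 0) (.imp (.pair_mem 3 5 0) (.eq 4 5))))))
    (.all (.imp
      (.ball 2 (.bex 2 (.pair_mem 4 5 3)))
      (.imp
        (.ball 2 (.ball 2 (.ball 2 (.imp (.pair_mem 4 6 3) (.imp (.pair_mem 5 6 3) (.eq 4 5))))))
        (.ball 2 (.ex (.and (.isSeq 5 1 2) (.and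
          (.ball 1 (.ball 2 (.imp (.pair_mem 6 7 5) (.bex 2 (.pair_mem 8 7 3)))))
          (.pair_mem 5 4 0))))))))

theorem exists_isJonsson {δ lam : Ordinal.{u}} (hδ : Order.IsSuccPrelimit δ) (hω : ω < lam)
    (hlam : lam < δ) :
    ∃ f : RankStruct A δ, IsJonsson f (ofOrdinal A (hω.trans hlam)) (ofOrdinal A hlam) ∧
      ∀ s : ℕ → Ordinal.{u}, (∀ n, s n < lam) →
        ∃ a < lam, ZFSet.pair (codeSeq s) a.toZFSet ∈ f.val := by
  have : Infinite (Set.Iio lam) :=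
    Infinite.of_injective (fun n : ℕ => (⟨n, (natCast_lt_omega0 n).trans hω⟩ : Set.Iio lam))
      fun m n h => Nat.cast_injective (congrArg Subtype.val h)
  obtain ⟨F, hF⟩ := exists_omega_jonsson (Set.Iio lam)
  let f : (ℕ → Set.Iio lam) → ZFSet.{u} := fun s =>
    ZFSet.pair (codeSeq fun n => (s n).1) (F s).1.toZFSet
  have hcode : ∀ s : ℕ → Set.Iio lam, (codeSeq fun n => (s n).1).rank <
      Order.succ (Order.succ (Order.succ lam)) := fun s =>
    Order.lt_succ_of_le (rank_codeSeq_le hω.le fun n => (s n).2)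
  -- Codes of sequences have rank below `lam + 3`, and each pairing adds two, so the function has
  -- rank at most `lam + 5`.
  have hf : (ZFSet.range f).rank < δ := by
    refine (ZFSet.rank_range_le fun s => ZFSet.rank_orderedPair_lt (hcode s) ?_).trans_lt
      (hδ.succ_lt (hδ.succ_lt (hδ.succ_lt (hδ.succ_lt (hδ.succ_lt hlam)))))
    rw [rank_toZFSet]
    refine lt_trans (F s).2 ?_
    exact (Order.lt_succ _).trans ((Order.lt_succ _).trans (Order.lt_succ _))
  refine ⟨⟨ZFSet.range f, ZFSet.mem_vonNeumann.2 hf⟩, ⟨?_, ?_⟩, ?_⟩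
  · intro t a b ha hb
    obtain ⟨s, hs⟩ := ZFSet.mem_range.1 ha
    obtain ⟨s', hs'⟩ := ZFSet.mem_range.1 hb
    rw [ZFSet.pair_inj] at hs hs'
    have hss' : s = s' := by
      funext n
      exact Subtype.ext (congrFun (codeSeq_injective (hs.1.trans hs'.1.symm)) n)
    rw [← hs.2, ← hs'.2, hss']
  · intro g hg hginj a ha
    change a ∈ lam.toZFSet at ha
    obtain ⟨a, halt, rfl⟩ := mem_toZFSet_iff.1 ha
    -- `g` is only a total injective relation, so a value is chosen at each point.
    have h1 : ∀ x : Set.Iio lam, ∃ y : Set.Iio lam,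
        ZFSet.pair x.1.toZFSet y.1.toZFSet ∈ g.val := by
      intro x
      obtain ⟨y, hy, hxy⟩ := hg _ (toZFSet_mem_toZFSet_iff.2 x.2)
      obtain ⟨y, hy', rfl⟩ := mem_toZFSet_iff.1 hy
      exact ⟨⟨y, hy'⟩, hxy⟩
    choose g₀ hg₀ using h1
    have hg₀inj : Function.Injective g₀ := by
      intro x y hxy
      refine Subtype.ext (toZFSet_injective (hginj _ (toZFSet_mem_toZFSet_iff.2 x.2) _
        (toZFSet_mem_toZFSet_iff.2 y.2) _ (toZFSet_mem_toZFSet_iff.2 (g₀ x).2) (hg₀ x) ?_))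
      rw [hxy]
      exact hg₀ y
    obtain ⟨s, hs⟩ := hF g₀ hg₀inj ⟨a, halt⟩
    refine ⟨⟨codeSeq fun n => (g₀ (s n)).1, ZFSet.mem_vonNeumann.2 ((hcode (g₀ ∘ s)).trans
      (hδ.succ_lt (hδ.succ_lt (hδ.succ_lt hlam))))⟩, ?_, ?_, ?_⟩
    · exact isSeq_iff.2 ⟨_, fun n => (g₀ (s n)).2, rfl⟩
    · intro m hm y _ hmy
      obtain ⟨m, hm', rfl⟩ := mem_toZFSet_iff.1 hm
      obtain ⟨n, rfl⟩ := lt_omega0.1 hm'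
      rw [pair_mem_codeSeq] at hmy
      exact ⟨_, toZFSet_mem_toZFSet_iff.2 (s n).2, hmy ▸ hg₀ (s n)⟩
    · refine ZFSet.mem_range.2 ⟨g₀ ∘ s, ?_⟩
      simp only [f, hs]
      rfl
  · intro s hs
    exact ⟨_, (F fun n => ⟨s n, hs n⟩).2, ZFSet.mem_range.2 ⟨fun n => ⟨s n, hs n⟩, rfl⟩⟩

/-! ### Kunen's inconsistency. -/

section Kunen

variable {δ γ κ : Ordinal.{u}} {j : RankStruct A δ ↪ₑ[setPredLang] RankStruct A γ}

/-- That the height is not a successor is first-order: every set is an element of some set. -/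
theorem isSuccPrelimit_of_embedding (j : RankStruct A δ ↪ₑ[setPredLang] RankStruct A γ)
    (hδ : Order.IsSuccPrelimit δ) : Order.IsSuccPrelimit γ := by
  have hD : Defn A (n := 0) fun α _ => ∀ x : RankStruct A α, ∃ y : RankStruct A α, x.val ∈ y.val :=
    .all (.ex (.mem 0 1))
  have := (hD.map j ![]).2 fun x => ⟨⟨{x.val}, ZFSet.mem_vonNeumann.2 (by
    rw [ZFSet.rank_singleton]
    exact hδ.succ_lt (ZFSet.mem_vonNeumann.1 x.2))⟩, by simp⟩
  refine Order.isSuccPrelimit_of_succ_lt fun o ho => ?_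
  obtain ⟨y, hy⟩ := this (ofOrdinal A ho)
  refine (Order.succ_le_of_lt ?_).trans_lt (ZFSet.mem_vonNeumann.1 y.2)
  have := ZFSet.rank_lt_of_mem hy
  rwa [show (ofOrdinal A ho).val = o.toZFSet from rfl, rank_toZFSet] at this

/-- Since `ω` and all natural numbers are fixed, the image is again an `ω`-sequence, with entries
computed pointwise. -/
theorem val_map_codeSeq (hj : IsCriticalPoint j κ) {μ : Ordinal.{u}} (hμ : μ < δ)
    {s : ℕ → Ordinal.{u}} (hs : ∀ n, s n < μ) {x : RankStruct A δ} (hx : x.val = codeSeq s) :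
    (j x).val = codeSeq fun n => ordMap j (s n) := by
  have hω := hj.omega0_lt.trans hj.lt
  have h : IsSeq (j x).val (j (ofOrdinal A hω)).val (j (ofOrdinal A hμ)).val :=
    ((Defn.isSeq (0 : Fin 3) 1 2).map j ![x, ofOrdinal A hω, ofOrdinal A hμ]).2
      (isSeq_iff.2 ⟨s, hs, hx⟩)
  rw [val_map_ofOrdinal, val_map_ofOrdinal, hj.ordMap_eq hj.omega0_lt, isSeq_iff] at h
  obtain ⟨s', _, hs'⟩ := h
  rw [hs']
  congr 1
  funext n
  have hn : (n : Ordinal.{u}) < κ := (natCast_lt_omega0 n).trans hj.omega0_lt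
  have hp : ZFSet.pair (j (ofOrdinal A (hn.trans hj.lt))).val
      (j (ofOrdinal A ((hs n).trans hμ))).val ∈ (j x).val :=
    ((Defn.pair_mem (0 : Fin 3) 1 2).map j
      ![ofOrdinal A (hn.trans hj.lt), ofOrdinal A ((hs n).trans hμ), x]).2 (by
        change ZFSet.pair (n : Ordinal.{u}).toZFSet (s n).toZFSet ∈ x.val
        rw [hx]
        exact pair_mem_codeSeq.2 rfl)
  rw [val_map_ofOrdinal, val_map_ofOrdinal, hj.ordMap_eq hn, hs', pair_mem_codeSeq] at hp
  exact (toZFSet_injective hp).symm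

/-- Kunen's inconsistency theorem, for embeddings of levels of limit height. -/
theorem ordMap_ne_of_lt (hδ : Order.IsSuccPrelimit δ) (hj : IsCriticalPoint j κ)
    {lam : Ordinal.{u}} (hκ : κ < lam) (hlam : lam < δ) : ordMap j lam ≠ lam := by
  intro hfix
  have hω := hj.omega0_lt.trans hκ
  have hγ := isSuccPrelimit_of_embedding j hδ
  have hlamγ : lam < γ := hfix ▸ ordMap_lt hlam
  obtain ⟨f, hf, hftot⟩ := exists_isJonsson (A := A) hδ hω hlam
  have hjf : IsJonsson (j f) (j (ofOrdinal A (hω.trans hlam))) (j (ofOrdinal A hlam)) :=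
    (Defn.isJonsson.map j ![f, ofOrdinal A (hω.trans hlam), ofOrdinal A hlam]).2 hf
  obtain ⟨hfun, hjf⟩ := hjf
  simp only [val_map_ofOrdinal, hfix, hj.ordMap_eq hj.omega0_lt] at hjf
  have hlt : ∀ {x : Ordinal.{u}}, x < lam → ordMap j x < lam := fun hx =>
    (ordMap_lt_ordMap hx hlam).trans_eq hfix
  let g : Set.Iio lam → ZFSet.{u} := fun x => ZFSet.pair x.1.toZFSet (ordMap j x.1).toZFSet
  have hgmem : ∀ {x y : ZFSet.{u}}, ZFSet.pair x y ∈ ZFSet.range g →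
      ∃ a < lam, x = a.toZFSet ∧ y = (ordMap j a).toZFSet := by
    intro x y h
    obtain ⟨a, ha⟩ := ZFSet.mem_range.1 h
    rw [ZFSet.pair_inj] at ha
    exact ⟨a, a.2, ha.1.symm, ha.2.symm⟩
  have hg : (ZFSet.range g).rank < γ := by
    refine (ZFSet.rank_range_le fun x => ZFSet.rank_orderedPair_lt (μ := lam) ?_ ?_).trans_lt
      (hγ.succ_lt (hγ.succ_lt hlamγ))
    · rw [rank_toZFSet]
      exact x.2
    · rw [rank_toZFSet]
      exact hlt x.2
  -- The Jónsson property of `j f` is applied to the graph of `j` on `lam`, with `κ` as the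
  -- prescribed value.
  obtain ⟨t, ht, htg, htf⟩ := hjf ⟨ZFSet.range g, ZFSet.mem_vonNeumann.2 hg⟩
    (by
      intro x hx
      obtain ⟨x, hx', rfl⟩ := mem_toZFSet_iff.1 hx
      exact ⟨_, toZFSet_mem_toZFSet_iff.2 (hlt hx'), ZFSet.mem_range.2 ⟨⟨x, hx'⟩, rfl⟩⟩)
    (by
      intro x _ x' _ y _ h h'
      obtain ⟨a, ha, rfl, rfl⟩ := hgmem h
      obtain ⟨b, hb, rfl, hab⟩ := hgmem h'
      rw [ordMap_injOn (ha.trans hlam) (hb.trans hlam) (toZFSet_injective hab)])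
    κ.toZFSet (toZFSet_mem_toZFSet_iff.2 hκ)
  obtain ⟨s', hs', hts'⟩ := isSeq_iff.1 ht
  have hs : ∀ n, ∃ a < lam, s' n = ordMap j a := by
    intro n
    obtain ⟨x, _, hx⟩ := htg (n : Ordinal.{u}).toZFSet
      (toZFSet_mem_toZFSet_iff.2 (natCast_lt_omega0 n)) _ (toZFSet_mem_toZFSet_iff.2 (hs' n))
      (by rw [hts']; exact pair_mem_codeSeq.2 rfl)
    obtain ⟨a, ha, _, h⟩ := hgmem hx
    exact ⟨a, ha, toZFSet_injective h⟩
  choose s hslt hs using hs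
  obtain ⟨a, ha, haf⟩ := hftot s hslt
  have hscode : codeSeq s ∈ V_ δ := ZFSet.mem_vonNeumann.2
    ((rank_codeSeq_le hω.le hslt).trans_lt (hδ.succ_lt (hδ.succ_lt hlam)))
  obtain ⟨u, hu⟩ : ∃ u : RankStruct A δ, u.val = codeSeq s := ⟨⟨_, hscode⟩, rfl⟩
  have hjs : (j u).val = t.val := by
    rw [val_map_codeSeq hj hlam hslt hu, hts']
    exact congrArg codeSeq (funext fun n => (hs n).symm)
  have hpair : ZFSet.pair (j u).val (j (ofOrdinal A (ha.trans hlam))).val ∈ (j f).val :=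
    ((Defn.pair_mem (0 : Fin 3) 1 2).map j ![u, ofOrdinal A (ha.trans hlam), f]).2 (by
      change ZFSet.pair u.val a.toZFSet ∈ f.val
      rwa [hu])
  rw [hjs] at hpair
  have hval := hfun t _ (ofOrdinal A (hκ.trans hlamγ)) hpair htf
  rw [val_map_ofOrdinal] at hval
  exact hj.ordMap_ne (ha.trans hlam) (toZFSet_injective hval)

/-- Every ordinal below the supremum is below some `c n`. By elementarity every ordinal below its
image is below some `j(c n) = c (n + 1)`, hence below the supremum. -/
theorem ordMap_iSup_eq (hδ : Order.IsSuccPrelimit δ) (hj : IsCriticalPoint j κ)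
    {μ : Ordinal.{u}} (hκμ : κ ≤ μ) (hμ : μ < δ) {c : ℕ → Ordinal.{u}} (hc : ∀ n, c n < μ)
    (hjc : ∀ n, ordMap j (c n) = c (n + 1)) : ordMap j (⨆ n, c n) = ⨆ n, c n := by
  set lam := ⨆ n, c n with hlam_def
  have hle : ∀ n, c n ≤ lam := Ordinal.le_iSup c
  have hlam : lam < δ := (Ordinal.iSup_le fun n => (hc n).le).trans_lt hμ
  have hω := hj.omega0_lt.trans hj.lt
  refine le_antisymm ?_ (le_ordMap hlam)
  by_contra! hlt
  have hcode : codeSeq c ∈ V_ δ := ZFSet.mem_vonNeumann.2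
    ((rank_codeSeq_le (hj.omega0_lt.le.trans hκμ) hc).trans_lt (hδ.succ_lt (hδ.succ_lt hμ)))
  obtain ⟨u, hu⟩ : ∃ u : RankStruct A δ, u.val = codeSeq c := ⟨⟨_, hcode⟩, rfl⟩
  have hD : Defn A (n := 4) fun _ v => ∀ x ∈ (v 0).val, ∃ n ∈ (v 1).val, ∃ y ∈ (v 2).val,
      ZFSet.pair n y ∈ (v 3).val ∧ x ∈ y :=
    .ball 0 (.bex 1 (.bex 2 (.and (.pair_mem 5 6 3) (.mem 4 6))))
  have := (hD.map j ![ofOrdinal A hlam, ofOrdinal A hω, ofOrdinal A hμ, u]).2 (by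
    intro x hx
    obtain ⟨x, hx', rfl⟩ := mem_toZFSet_iff.1 hx
    obtain ⟨n, hn⟩ := Ordinal.lt_iSup_iff.1 hx'
    exact ⟨_, toZFSet_mem_toZFSet_iff.2 (natCast_lt_omega0 n), _, toZFSet_mem_toZFSet_iff.2 (hc n),
      hu ▸ pair_mem_codeSeq.2 rfl, toZFSet_mem_toZFSet_iff.2 hn⟩)
  obtain ⟨m, hm, y, -, hmy, hy⟩ := this lam.toZFSet (by
    change _ ∈ (j (ofOrdinal A hlam)).val
    rw [val_map_ofOrdinal]
    exact toZFSet_mem_toZFSet_iff.2 hlt)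
  change m ∈ (j (ofOrdinal A hω)).val at hm
  change ZFSet.pair m y ∈ (j u).val at hmy
  rw [val_map_ofOrdinal, hj.ordMap_eq hj.omega0_lt] at hm
  obtain ⟨m, hm', rfl⟩ := mem_toZFSet_iff.1 hm
  obtain ⟨n, rfl⟩ := lt_omega0.1 hm'
  rw [val_map_codeSeq hj hμ hc hu, pair_mem_codeSeq] at hmy
  rw [hmy, toZFSet_mem_toZFSet_iff, hjc] at hy
  exact (hle (n + 1)).not_gt hy

end Kunen

end RankStruct

/-! ### The equivalence. -/

open RankStruct in
theorem lemma1p1 (A : Class.{u}) (κ : Cardinal.{u}) :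
    IsExtendibleFor A κ ↔
      ∀ lam : Ordinal.{u}, κ.ord < lam →
        ∃ (θ : Ordinal.{u}) (j : RankStruct A lam ↪ₑ[setPredLang] RankStruct A θ),
          IsCriticalPoint j κ.ord := by
  classical
  refine ⟨fun h lam hlam => ?_, fun h lam hlam => ?_⟩
  · obtain ⟨θ, j, hj, -⟩ := h lam hlam
    exact ⟨θ, j, hj⟩
  by_contra! H
  let S : Ordinal.{u} → Ordinal.{u} → Prop := fun β ζ =>
    ∃ k : RankStruct A lam ↪ₑ[setPredLang] RankStruct A ζ,
      IsCriticalPoint k κ.ord ∧ ordMap k κ.ord = β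
  have hSle : ∀ {β ζ}, S β ζ → β ≤ lam := by
    rintro _ ζ ⟨k, hk, rfl⟩
    have := H ζ k hk
    rwa [val_map_ofOrdinal, toZFSet_mem_toZFSet_iff, not_lt] at this
  -- By `hSle` the index set may be bounded by `lam`, so the supremum of the chosen targets exists.
  -- The default `0` is harmless.
  let Z : Set.Iic lam → Ordinal.{u} := fun β => if h : ∃ ζ, S β ζ then h.choose else 0
  have hZ : ∀ {β ζ}, S β ζ → ∃ η ≤ ⨆ β, Z β, S β η := by
    intro β ζ hβ
    have hex : ∃ ζ, S β ζ := ⟨ζ, hβ⟩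
    refine ⟨hex.choose, ?_, hex.choose_spec⟩
    have : Z ⟨β, hSle hβ⟩ = hex.choose := dif_pos hex
    rw [← this]
    exact Ordinal.le_iSup Z _
  obtain ⟨δ, hδ, hlamδ, hZδ⟩ : ∃ δ : Ordinal.{u}, Order.IsSuccPrelimit δ ∧ lam < δ ∧
      ⨆ β, Z β < δ := by
    have hlt : max lam (⨆ β, Z β) < max lam (⨆ β, Z β) + ω :=
      lt_add_of_pos_right _ omega0_pos
    exact ⟨_, (isSuccLimit_add _ isSuccLimit_omega0).isSuccPrelimit,
      (le_max_left _ _).trans_lt hlt, (le_max_right _ _).trans_lt hlt⟩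
  obtain ⟨θ, j, hj⟩ := h δ (hlam.trans hlamδ)
  have hbase : ∃ ζ, S (ordMap j κ.ord) ζ := by
    obtain ⟨ζ, k, hk⟩ := exists_restrict j hlamδ
    refine ⟨ζ, k, isCriticalPoint_iff.2 ⟨hlam, ?_, fun β hβ => ?_⟩, hk _ hlam⟩
    · rw [hk _ hlam]
      exact hj.lt_ordMap.ne'
    · rw [hk _ (hβ.trans hlam), hj.ordMap_eq hβ]
  have hstep : ∀ β, (∃ ζ, S β ζ) → ∃ ζ, S (ordMap j β) ζ := by
    rintro β ⟨_, hβ⟩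
    obtain ⟨ζ, hζ, k, hk, rfl⟩ := hZ hβ
    obtain ⟨ζ', k', hk'⟩ := exists_restrict j (hζ.trans_lt hZδ)
    have hcomp : ∀ η < lam, ordMap (k'.comp k) η = ordMap j (ordMap k η) := fun η hη => by
      rw [ordMap_comp k' hη, hk' _ (ordMap_lt hη)]
    refine ⟨ζ', k'.comp k, isCriticalPoint_iff.2 ⟨hlam, ?_, fun η hη => ?_⟩, hcomp _ hlam⟩
    · rw [hcomp _ hlam]
      -- The composite moves `κ` because `j` never takes the value `κ`.
      exact hj.ordMap_ne ((hSle hβ).trans_lt hlamδ)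
    · rw [hcomp _ (hη.trans hlam), hk.ordMap_eq hη, hj.ordMap_eq hη]
  let c : ℕ → Ordinal.{u} := fun n => (ordMap j)^[n] κ.ord
  have hjc : ∀ n, ordMap j (c n) = c (n + 1) := fun n =>
    (Function.iterate_succ_apply' _ _ _).symm
  have hcS : ∀ n, ∃ ζ, S (c (n + 1)) ζ := by
    intro n
    induction n with
    | zero => exact hbase
    | succ n ih =>
      rw [← hjc]
      exact hstep _ ih
  have hc : ∀ n, c n < Order.succ lam := by
    intro n
    rw [Order.lt_succ_iff]
    cases n with
    | zero => exact hlam.le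
    | succ n =>
      obtain ⟨ζ, hζ⟩ := hcS n
      exact hSle hζ
  have hμ := hδ.succ_lt hlamδ
  refine ordMap_ne_of_lt hδ hj ?_ ((Ordinal.iSup_le fun n => (hc n).le).trans_lt hμ)
    (ordMap_iSup_eq hδ hj (hlam.le.trans (Order.le_succ _)) hμ hc hjc)
  -- `c 1` is `j(κ)`, which already exceeds `κ`.
  exact hj.lt_ordMap.trans_le (Ordinal.le_iSup c 1)
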